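/- All logarithms are in base $2$. For a finite set $A$, a sequence $w\in A^{\mathbb N^*}$ ($\mathbb N^*=\{1,2,\dots\}$) and $n\ge 0$ let $p_n(w)$ be the number of blocks $B\in A^n$ that appear in $w$ (i.e. $w(t+j)=B(j)$ for $0\le j<n$, for some $t\ge 1$), let $h_{top}(w)=\lim_{n\to\infty}\frac1n\log p_n(w)$ (this limit exists), and let $X_w$ be the set of all $u\in A^{\mathbb N^*}$ such that every block appearing in $u$ appears in $w$. Let $\pi(w)=w^2$ denote the coordinatewise square, $\pi\colon\{-1,0,1\}^{\mathbb N^*}\to\{0,1\}^{\mathbb N^*}$. Let $H(x)=-x\log x-(1-x)\log(1-x)$ for $x\in[0,1]$ (with $0\log 0=0$), let $H_1=H|_{[0,1/2]}$ and $H_2=H|_{[1/2,1]}$, which are bijections onto $[0,1]$, and define $f_1,f_2\colon[0,1]\to\mathbb R$ by $$f_1(x)=x+H_1^{-1}(x),\qquad f_2(x)=\begin{cases}x+H_2^{-1}(x)&\text{for }x<H(2/3),\\ \log 3&\text{for }x\ge H(2/3).\end{cases}$$ Let $z\in\{-1,0,1\}^{\mathbb N^*}$. Then $h_{top}(z)\le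 f_2(h_{top}(z^2))$, and equality holds whenever $h_{top}(z)=\log 3$. If $h_{top}(z^2)>0$, then equality $h_{top}(z)=f_2(h_{top}(z^2))$ holds if and only if $h_{top}(z)=\log 3$. If, moreover, $X_z=\pi^{-1}(X_{z^2})$, then $f_1(h_{top}(z^2))\le h_{top}(z)$ (also when $h_{top}(z^2)=0$), and this inequality is strict if $h_{top}(z^2)>0$. -/

import Mathlib

namespace SymbDyn

/-- The block `B` of length `n` appears in the one-sided sequence `w = (w(1), w(2), …)`: for some
`t ≥ 1` one has `w(t + j) = B(j)` for `0 ≤ j < n`. -/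
def Appears {A : Type*} {n : ℕ} (B : Fin n → A) (w : ℕ+ → A) : Prop :=
  ∃ t : ℕ+, ∀ j : Fin n, w ⟨(t : ℕ) + (j : ℕ), Nat.add_pos_left t.pos _⟩ = B j

/-- The subshift `X_w`: all sequences `u` such that every block appearing in `u` appears in `w`. -/
def subshift {A : Type*} (w : ℕ+ → A) : Set (ℕ+ → A) :=
  {u | ∀ (n : ℕ) (B : Fin n → A), Appears B u → Appears B w}

/-- `p_n(w)`, the number of blocks of length `n` appearing in `w`. -/
noncomputable def blockCount {A : Type*} (w : ℕ+ → A) (n : ℕ) : ℕ :=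
  Set.ncard {B : Fin n → A | Appears B w}

/-- `h_top(w) = lim (1/n) log₂ p_n(w)`. The limit exists for every finite alphabet, see
`tendsto_topEntropy`. -/
noncomputable def topEntropy {A : Type*} (w : ℕ+ → A) : ℝ :=
  Filter.limUnder Filter.atTop (fun n : ℕ => 1 / (n : ℝ) * Real.logb 2 (blockCount w n))

theorem blockCount_pos {A : Type*} [Finite A] (w : ℕ+ → A) (n : ℕ) : 0 < blockCount w n := by
  unfold blockCount
  rw [Set.ncard_pos (Set.toFinite _)]
  exact ⟨fun j => w ⟨((1 : ℕ+) : ℕ) + (j : ℕ), Nat.add_pos_left (1 : ℕ+).pos _⟩, 1, fun _ => rfl⟩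

theorem blockCount_add_le {A : Type*} [Finite A] (w : ℕ+ → A) (m n : ℕ) :
    blockCount w (m + n) ≤ blockCount w m * blockCount w n := by
  unfold blockCount
  rw [← Set.ncard_prod]
  refine Set.ncard_le_ncard_of_injOn
    (fun B => (fun i => B (Fin.castAdd n i), fun j => B (Fin.natAdd m j))) ?_ ?_ (Set.toFinite _)
  · rintro B ⟨t, ht⟩
    refine ⟨⟨t, fun j => ht (Fin.castAdd n j)⟩,
      ⟨(⟨(t : ℕ) + m, Nat.add_pos_left t.pos _⟩ : ℕ+), fun j => ?_⟩⟩
    refine Eq.trans (congrArg w (PNat.eq ?_)) (ht (Fin.natAdd m j))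
    exact Nat.add_assoc _ _ _
  · intro B _ C _ h
    simp only [Prod.mk.injEq] at h
    funext i
    refine Fin.addCases (fun i => congrFun h.1 i) (fun j => congrFun h.2 j) i

theorem tendsto_topEntropy {A : Type*} [Finite A] (w : ℕ+ → A) :
    Filter.Tendsto (fun n : ℕ => 1 / (n : ℝ) * Real.logb 2 (blockCount w n)) Filter.atTop
      (nhds (topEntropy w)) := by
  have hpos : ∀ n, (0 : ℝ) < blockCount w n := fun n => by exact_mod_cast blockCount_pos w n
  have hsub : Subadditive (fun n : ℕ => Real.logb 2 (blockCount w n)) := by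
    intro m n
    rw [← Real.logb_mul (hpos m).ne' (hpos n).ne']
    refine Real.logb_le_logb_of_le (by norm_num) (hpos _) ?_
    exact_mod_cast blockCount_add_le w m n
  have hbdd : BddBelow (Set.range fun n : ℕ => Real.logb 2 (blockCount w n) / n) := by
    refine ⟨0, ?_⟩
    rintro _ ⟨n, rfl⟩
    refine div_nonneg (Real.logb_nonneg (by norm_num) ?_) (Nat.cast_nonneg n)
    exact_mod_cast blockCount_pos w n
  have h := hsub.tendsto_lim hbdd
  refine tendsto_nhds_limUnder ⟨hsub.lim, h.congr fun n => ?_⟩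
  ring

/-- The coordinate square map `π` on `{-1, 0, 1}^{ℕ*}`. The alphabet `{-1, 0, 1}` is `SignType`;
the squares lie in `{0, 1}^{ℕ*}`, seen inside `{-1, 0, 1}^{ℕ*}`. -/
def squareMap (w : ℕ+ → SignType) : ℕ+ → SignType := fun n => w n ^ 2

/-- The binary entropy function, in base `2`; with `log 0 = 0` it vanishes at `0` and at `1`. -/
noncomputable def H (x : ℝ) : ℝ := -x * Real.logb 2 x - (1 - x) * Real.logb 2 (1 - x)

/-- The inverse of `H` restricted to `[0, 1/2]`, a bijection onto `[0, 1]`. -/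
noncomputable def H₁inv (y : ℝ) : ℝ := Function.invFunOn H (Set.Icc 0 (1 / 2)) y

/-- The inverse of `H` restricted to `[1/2, 1]`, a bijection onto `[0, 1]`. -/
noncomputable def H₂inv (y : ℝ) : ℝ := Function.invFunOn H (Set.Icc (1 / 2) 1) y

theorem H_eq (x : ℝ) : H x = Real.binEntropy x / Real.log 2 := by
  simp only [H, Real.logb, Real.binEntropy, Real.log_inv]
  ring

theorem bijOn_H₁ : Set.BijOn H (Set.Icc 0 (1 / 2)) (Set.Icc 0 1) := by
  have hl : 0 < Real.log 2 := Real.log_pos (by norm_num)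
  have hmono : StrictMonoOn H (Set.Icc 0 (1 / 2)) := by
    intro x hx y hy hxy
    rw [H_eq, H_eq]
    refine div_lt_div_of_pos_right (Real.binEntropy_strictMonoOn ?_ ?_ hxy) hl <;>
      simpa using (by assumption : _ ∈ Set.Icc (0 : ℝ) (1 / 2))
  have h0 : H 0 = 0 := by simp [H_eq]
  have h1 : H (1 / 2) = 1 := by
    rw [H_eq, one_div, Real.binEntropy_two_inv, div_self hl.ne']
  have hc : Continuous H := by
    rw [show H = fun x => Real.binEntropy x / Real.log 2 from funext H_eq]
    exact Real.binEntropy_continuous.div_const _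
  refine ⟨fun x hx => ?_, hmono.injOn, ?_⟩
  · rw [← h0, ← h1]
    exact ⟨hmono.monotoneOn (by norm_num) hx hx.1, hmono.monotoneOn hx (by norm_num) hx.2⟩
  · have := intermediate_value_Icc (by norm_num : (0 : ℝ) ≤ 1 / 2) hc.continuousOn
    rwa [h0, h1] at this

theorem bijOn_H₂ : Set.BijOn H (Set.Icc (1 / 2) 1) (Set.Icc 0 1) := by
  have hs : ∀ x, H (1 - x) = H x := fun x => by rw [H_eq, H_eq, Real.binEntropy_one_sub]
  have hb : Set.BijOn (fun x : ℝ => 1 - x) (Set.Icc (1 / 2) 1) (Set.Icc 0 (1 / 2)) := by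
    refine ⟨fun x hx => ⟨by linarith [hx.2], by linarith [hx.1]⟩, fun x _ y _ h => ?_,
      fun x hx => ⟨1 - x, ⟨by linarith [hx.2], by linarith [hx.1]⟩, by ring⟩⟩
    have : 1 - x = 1 - y := h
    linarith
  exact (bijOn_H₁.comp hb).congr fun x _ => hs x

/-- `f₁(x) = x + H₁⁻¹(x)`, to be used on `[0, 1]`. -/
noncomputable def f₁ (x : ℝ) : ℝ := x + H₁inv x

open Classical in
/-- `f₂(x) = x + H₂⁻¹(x)` for `x < H(2/3)` and `log₂ 3` for `x ≥ H(2/3)`, to be used on `[0, 1]`. -/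
noncomputable def f₂ (x : ℝ) : ℝ := if x < H (2 / 3) then x + H₂inv x else Real.logb 2 3

end SymbDyn

/-! Write y = z², h = h_top(y). A block B of y lifts to at most 2^(number of ones in B) blocks of z,
and to exactly that many when X_z is the full preimage. So p_n(z) is compared with a sum of product
weights over the blocks of y.

Hölder relates three such sums: the weight 1 (giving p_n(y)), the fibre sizes (1 at the letter 0, 2
at 1), and the Bernoulli(q) measure, whose total over the blocks of y is at most 1. Each weight has
two values, so up to a constant one is a product of powers of the other two; the exponents depend on
s = log(q/(1-q)). Choosing H(q) = h turns the constant into h + q. For q > 2/3 one has s > 1 and the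
fibre weight is interpolated, which gives the upper bound (`topEntropy_lt_add_of_hasMissingWord`).
For q ≤ 1/2 one has s ≤ 0 and the weight 1 is interpolated, which gives the lower bound
(`add_lt_topEntropy_of_hasMissingWord`).

Strictness: if some 0-1 word is missing from y, the Bernoulli total decays exponentially. If none is
missing, then h = 1 and, under the preimage hypothesis, h_top(z) = log 3. For h ≥ H(2/3) the upper
bound is the trivial log 3. -/

namespace SymbDyn

open Filter Topology

/-! ### Weighted block sums and their submultiplicativity -/

section BlockSum

variable {A : Type*} [Fintype A]

open Classical in
/-- The weighted count of the blocks of length `n` of `y`: a block has weight `∏ φ (B i)`. -/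
noncomputable def blockSum (y : ℕ+ → A) (φ : A → ℝ) (n : ℕ) : ℝ :=
  ∑ B : Fin n → A with Appears B y, ∏ i, φ (B i)

theorem blockSum_one (y : ℕ+ → A) (n : ℕ) : blockSum y (fun _ => 1) n = blockCount y n := by
  classical
  simp only [blockSum, Finset.prod_const_one, Finset.sum_const, nsmul_eq_mul, mul_one, blockCount]
  rw [Set.ncard_eq_toFinset_card', Set.toFinset_ofPred]

theorem blockSum_nonneg (y : ℕ+ → A) {φ : A → ℝ} (h : ∀ a, 0 ≤ φ a) (n : ℕ) :
    0 ≤ blockSum y φ n :=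
  Finset.sum_nonneg fun _ _ => Finset.prod_nonneg fun _ _ => h _

theorem Appears.mem_range {A : Type*} {n : ℕ} {B : Fin n → A} {y : ℕ+ → A} (h : Appears B y) (i : Fin n) :
    B i ∈ Set.range y := by
  obtain ⟨t, ht⟩ := h
  exact ⟨_, ht i⟩

theorem appears_shift {A : Type*} (y : ℕ+ → A) (t : ℕ+) (n : ℕ) :
    Appears (fun j : Fin n => y ⟨(t : ℕ) + (j : ℕ), Nat.add_pos_left t.pos _⟩) y :=
  ⟨t, fun _ => rfl⟩

theorem blockSum_pos (y : ℕ+ → A) {φ : A → ℝ} (h : ∀ a ∈ Set.range y, 0 < φ a) (n : ℕ) :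
    0 < blockSum y φ n := by
  classical
  refine Finset.sum_pos (fun B hB => Finset.prod_pos fun i _ =>
    h _ ((Finset.mem_filter.1 hB).2.mem_range i)) ⟨_, Finset.mem_filter.2
      ⟨Finset.mem_univ _, appears_shift y 1 n⟩⟩

theorem blockSum_add_le (y : ℕ+ → A) {φ : A → ℝ} (h : ∀ a, 0 ≤ φ a) (m n : ℕ) :
    blockSum y φ (m + n) ≤ blockSum y φ m * blockSum y φ n := by
  classical
  unfold blockSum
  rw [Finset.sum_mul_sum, ← Finset.sum_product']
  let g : (Fin (m + n) → A) → (Fin m → A) × (Fin n → A) :=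
    fun B => (fun i => B (Fin.castAdd n i), fun j => B (Fin.natAdd m j))
  have hg : Function.Injective g := by
    intro B C hBC
    simp only [g, Prod.mk.injEq] at hBC
    funext i
    exact Fin.addCases (fun i => congrFun hBC.1 i) (fun j => congrFun hBC.2 j) i
  have hsum : ∀ B : Fin (m + n) → A,
      ∏ i, φ (B i) = (∏ i, φ ((g B).1 i)) * ∏ i, φ ((g B).2 i) := fun B => by
    rw [Fin.prod_univ_add]
  simp only [hsum]
  rw [← Finset.sum_image (f := fun p : (Fin m → A) × (Fin n → A) =>
    (∏ i, φ (p.1 i)) * ∏ i, φ (p.2 i)) (g := g) hg.injOn]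
  refine Finset.sum_le_sum_of_subset_of_nonneg ?_ fun p _ _ =>
    mul_nonneg (Finset.prod_nonneg fun _ _ => h _) (Finset.prod_nonneg fun _ _ => h _)
  intro p hp
  obtain ⟨B, hB, rfl⟩ := Finset.mem_image.1 hp
  obtain ⟨t, ht⟩ := (Finset.mem_filter.1 hB).2
  refine Finset.mem_product.2 ⟨Finset.mem_filter.2 ⟨Finset.mem_univ _, t, fun j =>
    ht (Fin.castAdd n j)⟩, Finset.mem_filter.2 ⟨Finset.mem_univ _,
      (⟨(t : ℕ) + m, Nat.add_pos_left t.pos _⟩ : ℕ+), fun j => ?_⟩⟩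
  refine Eq.trans (congrArg y (PNat.eq ?_)) (ht (Fin.natAdd m j))
  exact Nat.add_assoc _ _ _

theorem blockSum_le_pow_sum (y : ℕ+ → A) {φ : A → ℝ} (h : ∀ a, 0 ≤ φ a) (n : ℕ) :
    blockSum y φ n ≤ (∑ a, φ a) ^ n := by
  classical
  rw [← Fintype.card_fin n, ← Finset.card_univ, ← Finset.prod_const, Finset.prod_univ_sum,
    Fintype.piFinset_univ]
  simp only [Finset.card_univ, Fintype.card_fin]
  exact Finset.sum_le_sum_of_subset_of_nonneg (Finset.filter_subset _ _) fun B _ _ =>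
    Finset.prod_nonneg fun _ _ => h _

theorem blockSum_lt_pow_sum (y : ℕ+ → A) {φ : A → ℝ} (h : ∀ a, 0 ≤ φ a) {n : ℕ}
    {B : Fin n → A} (hB : ¬ Appears B y) (hpos : ∀ i, 0 < φ (B i)) :
    blockSum y φ n < (∑ a, φ a) ^ n := by
  classical
  have : (∑ a, φ a) ^ n = ∑ C : Fin n → A, ∏ i, φ (C i) := by
    have := Finset.prod_univ_sum (fun _ : Fin n => (Finset.univ : Finset A)) fun _ a => φ a
    simpa using this
  rw [this]
  exact Finset.sum_lt_sum_of_subset (Finset.filter_subset _ _) (Finset.mem_univ B)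
    (by simp [hB]) (Finset.prod_pos fun i _ => hpos i)
    fun _ _ _ => Finset.prod_nonneg fun _ _ => h _

theorem blockSum_mul_le (y : ℕ+ → A) {φ : A → ℝ} (h : ∀ a, 0 ≤ φ a) (m k : ℕ) :
    blockSum y φ (m * k) ≤ blockSum y φ m ^ k := by
  induction k with
  | zero => simpa using blockSum_le_pow_sum y h 0
  | succ k ih =>
    rw [Nat.mul_succ, pow_succ]
    exact (blockSum_add_le y h _ _).trans
      (mul_le_mul_of_nonneg_right ih (blockSum_nonneg y h m))

end BlockSum

/-! ### Hölder's inequality over blocks -/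

/-- Hölder's inequality for finite sums, with weights `a + c = 1`. -/
theorem sum_rpow_mul_rpow_le {ι : Type*} (s : Finset ι) {f g : ι → ℝ} {a c : ℝ}
    (ha : 0 ≤ a) (hc : 0 ≤ c) (hac : a + c = 1) (hf : ∀ i ∈ s, 0 ≤ f i) (hg : ∀ i ∈ s, 0 ≤ g i)
    (hF : 0 < ∑ i ∈ s, f i) (hG : 0 < ∑ i ∈ s, g i) :
    ∑ i ∈ s, f i ^ a * g i ^ c ≤ (∑ i ∈ s, f i) ^ a * (∑ i ∈ s, g i) ^ c := by
  set F := ∑ i ∈ s, f i with hFdef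
  set G := ∑ i ∈ s, g i with hGdef
  have key : ∑ i ∈ s, (f i / F) ^ a * (g i / G) ^ c ≤ 1 := by
    calc ∑ i ∈ s, (f i / F) ^ a * (g i / G) ^ c
        ≤ ∑ i ∈ s, (a * (f i / F) + c * (g i / G)) := Finset.sum_le_sum fun i hi =>
          Real.geom_mean_le_arith_mean2_weighted ha hc (div_nonneg (hf i hi) hF.le)
            (div_nonneg (hg i hi) hG.le) hac
      _ = 1 := by
        rw [Finset.sum_add_distrib, ← Finset.mul_sum, ← Finset.mul_sum, ← Finset.sum_div,
          ← Finset.sum_div, ← hFdef, ← hGdef, div_self hF.ne', div_self hG.ne']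
        linarith
  have hFa : 0 < F ^ a := Real.rpow_pos_of_pos hF a
  have hGc : 0 < G ^ c := Real.rpow_pos_of_pos hG c
  have : ∑ i ∈ s, (f i / F) ^ a * (g i / G) ^ c
      = (∑ i ∈ s, f i ^ a * g i ^ c) / (F ^ a * G ^ c) := by
    rw [Finset.sum_div]
    refine Finset.sum_congr rfl fun i hi => ?_
    rw [Real.div_rpow (hf i hi) hF.le, Real.div_rpow (hg i hi) hG.le, div_mul_div_comm]
  rwa [this, div_le_one (mul_pos hFa hGc)] at key

/-- Block weights are products, so an inequality between letter weights multiplies up to blocks;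
Hölder then separates the two factors. -/
theorem blockSum_le_of_letterwise {A : Type*} [Fintype A] (y : ℕ+ → A) {f g k : A → ℝ}
    {C a c : ℝ} (hC : 0 ≤ C) (ha : 0 ≤ a) (hc : 0 ≤ c) (hac : a + c = 1)
    (hf : ∀ b ∈ Set.range y, 0 ≤ f b)
    (hg : ∀ b ∈ Set.range y, 0 < g b) (hk : ∀ b ∈ Set.range y, 0 < k b)
    (h : ∀ b ∈ Set.range y, f b ≤ C * (g b ^ a * k b ^ c)) (n : ℕ) :
    blockSum y f n ≤ C ^ n * (blockSum y g n ^ a * blockSum y k n ^ c) := by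
  classical
  have hG := blockSum_pos y hg n
  have hK := blockSum_pos y hk n
  have hmem : ∀ B ∈ Finset.univ.filter (fun B : Fin n → A => Appears B y),
      ∀ i, B i ∈ Set.range y := fun B hB => (Finset.mem_filter.1 hB).2.mem_range
  unfold blockSum at hG hK ⊢
  refine le_trans ?_ (mul_le_mul_of_nonneg_left (sum_rpow_mul_rpow_le _ ha hc hac
    (fun B hB => Finset.prod_nonneg fun i _ => (hg _ (hmem B hB i)).le)
    (fun B hB => Finset.prod_nonneg fun i _ => (hk _ (hmem B hB i)).le) hG hK) (pow_nonneg hC n))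
  rw [Finset.mul_sum]
  refine Finset.sum_le_sum fun B hB => ?_
  rw [← Real.finsetProd_rpow _ _ fun i _ => (hg _ (hmem B hB i)).le,
    ← Real.finsetProd_rpow _ _ fun i _ => (hk _ (hmem B hB i)).le, ← Finset.prod_mul_distrib]
  calc ∏ i, f (B i) ≤ ∏ i, C * (g (B i) ^ a * k (B i) ^ c) :=
        Finset.prod_le_prod (fun i _ => hf _ (hmem B hB i)) fun i _ => h _ (hmem B hB i)
    _ = _ := by simp [Finset.prod_mul_distrib]

/-! ### Fibres of squaring -/

/-- The size of the fibre of `x ↦ x ^ 2` over `b`. -/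
def sqFiber (b : SignType) : ℕ := (Finset.univ.filter fun x : SignType => x ^ 2 = b).card

theorem squareMap_range {z : ℕ+ → SignType} {b : SignType}
    (hb : b ∈ Set.range (squareMap z)) : b = 0 ∨ b = 1 := by
  obtain ⟨n, rfl⟩ := hb
  unfold squareMap
  generalize z n = x
  revert x
  decide

theorem Appears.squareMap {z : ℕ+ → SignType} {n : ℕ} {B : Fin n → SignType}
    (h : Appears B z) : Appears (fun i => B i ^ 2) (squareMap z) := by
  obtain ⟨t, ht⟩ := h
  exact ⟨t, fun j => congrArg (· ^ 2) (ht j)⟩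

theorem card_squareMap_fiber {n : ℕ} (B : Fin n → SignType) :
    (Finset.univ.filter fun C : Fin n → SignType => (fun i => C i ^ 2) = B).card
      = ∏ i, sqFiber (B i) := by
  unfold sqFiber
  rw [← Fintype.card_piFinset]
  congr 1
  ext C
  simp [funext_iff]

theorem blockCount_le_blockSum_sqFiber (z : ℕ+ → SignType) (n : ℕ) :
    (blockCount z n : ℝ) ≤ blockSum (squareMap z) (fun b => (sqFiber b : ℝ)) n := by
  classical
  unfold blockCount blockSum
  rw [Set.ncard_eq_toFinset_card', Set.toFinset_ofPred]
  simp only [← Nat.cast_prod, ← Nat.cast_sum]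
  norm_cast
  rw [Finset.card_eq_sum_card_fiberwise (f := fun C : Fin n → SignType => fun i => C i ^ 2)
    (t := Finset.univ.filter fun B : Fin n → SignType => Appears B (squareMap z))
    fun C hC => by simpa using Appears.squareMap (by simpa using hC)]
  refine Finset.sum_le_sum fun B _ => ?_
  rw [← card_squareMap_fiber]
  exact Finset.card_le_card (Finset.filter_subset_filter _ (Finset.subset_univ _))

/-- Splicing B into z at an occurrence of B² leaves the square a tail of z², so the spliced sequence
lies in the preimage, hence in X_z. -/
theorem appears_of_sq_appears {z : ℕ+ → SignType}
    (hz : subshift z = squareMap ⁻¹' subshift (squareMap z)) {n : ℕ} {B : Fin n → SignType}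
    (h : Appears (fun i => B i ^ 2) (squareMap z)) : Appears B z := by
  obtain ⟨t, ht⟩ := h
  -- Positions start at 1, hence the shift: `u` is B followed by z from position t + n on.
  let u : ℕ+ → SignType := fun j =>
    if hj : (j : ℕ) - 1 < n then B ⟨(j : ℕ) - 1, hj⟩
    else z ⟨(t : ℕ) + ((j : ℕ) - 1), Nat.add_pos_left t.pos _⟩
  have hu2 : ∀ j, squareMap u j
      = squareMap z ⟨(t : ℕ) + ((j : ℕ) - 1), Nat.add_pos_left t.pos _⟩ := by
    intro j
    by_cases hj : (j : ℕ) - 1 < n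
    · rw [ht ⟨(j : ℕ) - 1, hj⟩]
      simp [squareMap, u, hj]
    · simp [squareMap, u, hj]
  have hu : u ∈ subshift z := by
    rw [hz]
    rintro m C ⟨r, hr⟩
    refine ⟨⟨(t : ℕ) + ((r : ℕ) - 1), Nat.add_pos_left t.pos _⟩, fun j => ?_⟩
    refine Eq.trans (congrArg (squareMap z) (PNat.eq ?_)) ((hu2 _).symm.trans (hr j))
    have := r.pos
    simp only [PNat.mk_coe]
    omega
  refine hu n B ⟨1, fun j => ?_⟩
  simp [u]

theorem blockCount_eq_blockSum_sqFiber {z : ℕ+ → SignType}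
    (hz : subshift z = squareMap ⁻¹' subshift (squareMap z)) (n : ℕ) :
    (blockCount z n : ℝ) = blockSum (squareMap z) (fun b => (sqFiber b : ℝ)) n := by
  classical
  unfold blockCount blockSum
  rw [Set.ncard_eq_toFinset_card', Set.toFinset_ofPred]
  simp only [← Nat.cast_prod, ← Nat.cast_sum]
  norm_cast
  rw [Finset.card_eq_sum_card_fiberwise (f := fun C : Fin n → SignType => fun i => C i ^ 2)
    (t := Finset.univ.filter fun B : Fin n → SignType => Appears B (squareMap z))
    fun C hC => by simpa using Appears.squareMap (by simpa using hC)]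
  refine Finset.sum_congr rfl fun B hB => ?_
  rw [← card_squareMap_fiber, Finset.filter_filter]
  congr 1
  ext C
  simp only [Finset.mem_filter, Finset.mem_univ, true_and, and_iff_right_iff_imp]
  rintro rfl
  exact appears_of_sq_appears hz (Finset.mem_filter.1 hB).2

/-- Taking limits along multiples of m, submultiplicativity bounds the growth rate of the weighted
sum by its value at the single length m. -/
theorem topEntropy_le_of_blockCount_le {A B D : Type*} [Finite A] [Finite B] [Fintype D]
    (u : ℕ+ → A) (v : ℕ+ → B) (y : ℕ+ → D) {w : D → ℝ} (hw : ∀ d, 0 ≤ w d)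
    (hw' : ∀ d ∈ Set.range y, 0 < w d) {C a c : ℝ} (hC : 0 < C) (hc : 0 ≤ c)
    (h : ∀ n, (blockCount u n : ℝ) ≤ C ^ n * ((blockCount v n : ℝ) ^ a * blockSum y w n ^ c))
    {m : ℕ} (hm : 0 < m) :
    topEntropy u ≤ Real.logb 2 C + a * topEntropy v + c * (Real.logb 2 (blockSum y w m) / m) := by
  have hsub : Tendsto (fun k : ℕ => m * k) atTop atTop := tendsto_id.const_mul_atTop' hm
  have hu := (tendsto_topEntropy u).comp hsub
  have hv := (tendsto_topEntropy v).comp hsub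
  refine le_of_tendsto_of_tendsto hu (((hv.const_mul a).const_add (Real.logb 2 C)).add_const _) ?_
  filter_upwards [eventually_gt_atTop 0] with k hk
  have hn : (0 : ℝ) < ((m * k : ℕ) : ℝ) := by exact_mod_cast Nat.mul_pos hm hk
  have pu : (0 : ℝ) < blockCount u (m * k) := by exact_mod_cast blockCount_pos u _
  have pv : (0 : ℝ) < blockCount v (m * k) := by exact_mod_cast blockCount_pos v _
  have pz := blockSum_pos y hw' (m * k)
  have hz : Real.logb 2 (blockSum y w (m * k)) ≤ k * Real.logb 2 (blockSum y w m) := by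
    rw [← Real.logb_pow]
    exact Real.logb_le_logb_of_le (by norm_num) pz (blockSum_mul_le y hw m k)
  have h1 := Real.logb_le_logb_of_le (by norm_num : (1 : ℝ) < 2) pu (h (m * k))
  rw [Real.logb_mul (pow_pos hC _).ne' (mul_pos (Real.rpow_pos_of_pos pv a)
      (Real.rpow_pos_of_pos pz c)).ne', Real.logb_mul (Real.rpow_pos_of_pos pv a).ne'
      (Real.rpow_pos_of_pos pz c).ne', Real.logb_pow, Real.logb_rpow_eq_mul_logb_of_pos pv,
      Real.logb_rpow_eq_mul_logb_of_pos pz] at h1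
  have h2 := h1.trans (add_le_add_right (add_le_add_right (mul_le_mul_of_nonneg_left hz hc) _) _)
  have h3 := mul_le_mul_of_nonneg_left h2 (one_div_pos.2 hn).le
  refine h3.trans_eq ?_
  have hm' : (m : ℝ) ≠ 0 := by positivity
  have hk' : (k : ℝ) ≠ 0 := by positivity
  simp only [Function.comp, Nat.cast_mul]
  field_simp
  ring

/-! ### Bernoulli weights and missing words -/

/-- The Bernoulli weights on `{0, 1}`, with `P(1) = q`. -/
noncomputable def bernoulliWeight (q : ℝ) (b : SignType) : ℝ :=
  if b = 0 then 1 - q else if b = 1 then q else 0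

theorem bernoulliWeight_zero (q : ℝ) : bernoulliWeight q 0 = 1 - q := by simp [bernoulliWeight]

theorem bernoulliWeight_one (q : ℝ) : bernoulliWeight q 1 = q := by simp [bernoulliWeight]

theorem sum_bernoulliWeight (q : ℝ) : ∑ b, bernoulliWeight q b = 1 := by
  have : (Finset.univ : Finset SignType) = {0, -1, 1} := rfl
  rw [this, Finset.sum_insert (by decide), Finset.sum_insert (by decide), Finset.sum_singleton]
  simp [bernoulliWeight]

theorem bernoulliWeight_nonneg {q : ℝ} (h0 : 0 ≤ q) (h1 : q ≤ 1) (b : SignType) :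
    0 ≤ bernoulliWeight q b := by
  unfold bernoulliWeight
  split_ifs <;> linarith

theorem bernoulliWeight_pos {q : ℝ} (h0 : 0 < q) (h1 : q < 1) {b : SignType}
    (hb : b = 0 ∨ b = 1) : 0 < bernoulliWeight q b := by
  rcases hb with rfl | rfl
  · rw [bernoulliWeight_zero]; linarith
  · rwa [bernoulliWeight_one]

theorem sqFiber_zero : sqFiber 0 = 1 := rfl

theorem sqFiber_one : sqFiber 1 = 2 := rfl

/-- Some word over `{0, 1}` does not appear in `y`. -/
def HasMissingWord (y : ℕ+ → SignType) : Prop :=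
  ∃ (m : ℕ) (B : Fin m → SignType), (∀ i, B i = 0 ∨ B i = 1) ∧ ¬ Appears B y

theorem HasMissingWord.exists_blockSum_lt {y : ℕ+ → SignType} (h : HasMissingWord y)
    {q : ℝ} (h0 : 0 < q) (h1 : q < 1) :
    ∃ m : ℕ, 0 < m ∧ blockSum y (bernoulliWeight q) m < 1 := by
  obtain ⟨m, B, hB, hm⟩ := h
  refine ⟨m, Nat.pos_of_ne_zero ?_, ?_⟩
  · rintro rfl
    exact hm ⟨1, fun j => j.elim0⟩
  · simpa [sum_bernoulliWeight] using blockSum_lt_pow_sum y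
      (bernoulliWeight_nonneg h0.le h1.le) hm fun i => bernoulliWeight_pos h0 h1 (hB i)

/-! ### Elementary entropy bounds -/

theorem le_topEntropy_of_pow_le {A : Type*} [Finite A] (u : ℕ+ → A) {c : ℝ} (hc : 0 < c)
    (h : ∀ n, c ^ n ≤ (blockCount u n : ℝ)) : Real.logb 2 c ≤ topEntropy u := by
  refine ge_of_tendsto (tendsto_topEntropy u) ?_
  filter_upwards [eventually_gt_atTop 0] with n hn
  have hn' : (0 : ℝ) < n := by exact_mod_cast hn
  have := Real.logb_le_logb_of_le (by norm_num : (1 : ℝ) < 2) (pow_pos hc n) (h n)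
  rw [Real.logb_pow] at this
  rw [one_div_mul_eq_div, le_div_iff₀ hn']
  linarith

theorem topEntropy_nonneg {A : Type*} [Finite A] (u : ℕ+ → A) : 0 ≤ topEntropy u := by
  have := le_topEntropy_of_pow_le u one_pos fun n => by
    rw [one_pow]; exact_mod_cast blockCount_pos u n
  simpa using this

theorem topEntropy_le_of_le_pow {A : Type*} [Finite A] (u : ℕ+ → A) {c : ℝ}
    (h : ∀ n, (blockCount u n : ℝ) ≤ c ^ n) : topEntropy u ≤ Real.logb 2 c := by
  refine le_of_tendsto (tendsto_topEntropy u) ?_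
  filter_upwards [eventually_gt_atTop 0] with n hn
  have hn' : (0 : ℝ) < n := by exact_mod_cast hn
  have hp : (0 : ℝ) < blockCount u n := by exact_mod_cast blockCount_pos u n
  have := Real.logb_le_logb_of_le (by norm_num : (1 : ℝ) < 2) hp (h n)
  rw [Real.logb_pow] at this
  rw [one_div_mul_eq_div, div_le_iff₀ hn']
  linarith

theorem topEntropy_le_logb_three (z : ℕ+ → SignType) : topEntropy z ≤ Real.logb 2 3 := by
  refine topEntropy_le_of_le_pow z fun n => ?_
  have h := blockSum_le_pow_sum z (φ := fun _ => 1) (fun _ => zero_le_one) n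
  rw [blockSum_one] at h
  refine h.trans_eq ?_
  congr 1
  simp
  norm_cast

theorem topEntropy_squareMap_le_one (z : ℕ+ → SignType) : topEntropy (squareMap z) ≤ 1 := by
  rw [← Real.logb_self_eq_one (by norm_num : (1 : ℝ) < 2)]
  refine topEntropy_le_of_le_pow _ fun n => ?_
  have hpos : ∀ b ∈ Set.range (squareMap z), 0 < bernoulliWeight (1 / 2) b := fun b hb =>
    bernoulliWeight_pos (by norm_num) (by norm_num) (squareMap_range hb)
  have h := blockSum_le_of_letterwise (squareMap z) (f := fun _ => 1)
    (g := bernoulliWeight (1 / 2)) (k := bernoulliWeight (1 / 2)) (C := 2) (a := 1) (c := 0)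
    (by norm_num) zero_le_one le_rfl (by norm_num) (fun _ _ => zero_le_one) hpos hpos
    (fun b hb => by
      rcases squareMap_range hb with rfl | rfl
      · norm_num [bernoulliWeight_zero]
      · norm_num [bernoulliWeight_one]) n
  have h1 := blockSum_le_pow_sum (squareMap z)
    (bernoulliWeight_nonneg (q := 1 / 2) (by norm_num) (by norm_num)) n
  rw [sum_bernoulliWeight, one_pow] at h1
  rw [blockSum_one, Real.rpow_one, Real.rpow_zero, mul_one] at h
  exact h.trans (mul_le_of_le_one_right (by positivity) h1)

theorem one_le_topEntropy_of_not_hasMissingWord {y : ℕ+ → SignType} (h : ¬ HasMissingWord y) :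
    1 ≤ topEntropy y := by
  classical
  rw [← Real.logb_self_eq_one (by norm_num : (1 : ℝ) < 2)]
  refine le_topEntropy_of_pow_le _ (by norm_num) fun n => ?_
  have hcard : (Fintype.piFinset fun _ : Fin n => ({0, 1} : Finset SignType)).card = 2 ^ n := by
    rw [Fintype.card_piFinset]
    simp
  have : (2 : ℝ) ^ n = ((2 ^ n : ℕ) : ℝ) := by push_cast; rfl
  rw [this, ← hcard, Nat.cast_le, blockCount, Set.ncard_eq_toFinset_card']
  refine Finset.card_le_card fun B hB => ?_
  rw [Set.mem_toFinset]
  by_contra hB'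
  exact h ⟨n, B, fun i => by simpa using Fintype.mem_piFinset.1 hB i, hB'⟩

theorem logb_three_le_topEntropy {z : ℕ+ → SignType} (h : ¬ HasMissingWord (squareMap z))
    (hz : subshift z = squareMap ⁻¹' subshift (squareMap z)) :
    Real.logb 2 3 ≤ topEntropy z := by
  refine le_topEntropy_of_pow_le _ (by norm_num) fun n => ?_
  have : {B : Fin n → SignType | Appears B z} = Set.univ := by
    refine Set.eq_univ_of_forall fun B => appears_of_sq_appears hz ?_
    by_contra hB
    refine h ⟨n, _, fun i => ?_, hB⟩
    generalize B i = x
    revert x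
    decide
  have hc : Nat.card (Fin n → SignType) = 3 ^ n := by
    rw [Nat.card_eq_fintype_card, Fintype.card_fun, Fintype.card_fin]
    rfl
  rw [blockCount, this, Set.ncard_univ, hc]
  push_cast
  exact le_rfl

/-! ### The two strict bounds -/

theorem H_eq_mul_add {q : ℝ} (h0 : 0 < q) (h1 : q < 1) :
    H q = -(q * Real.logb 2 (q / (1 - q))) - Real.logb 2 (1 - q) := by
  rw [H, Real.logb_div h0.ne' (by linarith)]
  ring

theorem topEntropy_lt_add_of_hasMissingWord {z : ℕ+ → SignType}
    (hy : HasMissingWord (squareMap z)) {q : ℝ} (h0 : 2 / 3 < q) (h1 : q < 1)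
    (hq : H q = topEntropy (squareMap z)) :
    topEntropy z < topEntropy (squareMap z) + q := by
  have q0 : 0 < q := by linarith
  have q1 : 0 < 1 - q := by linarith
  obtain ⟨m, hm, hlt⟩ := hy.exists_blockSum_lt q0 h1
  set s := Real.logb 2 (q / (1 - q)) with hs
  have hs1 : 1 < s := by
    rw [hs, Real.lt_logb_iff_rpow_lt (by norm_num) (div_pos q0 q1), Real.rpow_one,
      lt_div_iff₀ q1]
    linarith
  have hs0 : 0 < s := by linarith
  have hpos : ∀ b ∈ Set.range (squareMap z), 0 < bernoulliWeight q b := fun b hb =>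
    bernoulliWeight_pos q0 h1 (squareMap_range hb)
  have hC : 0 < (1 - q) ^ (-s⁻¹) := Real.rpow_pos_of_pos q1 _
  -- The exponent 1/s is forced by (q/(1-q))^(1/s) = 2, and C by the letter 0; both letters then
  -- give equality. Hölder needs 1/s ≤ 1, that is q ≥ 2/3.
  have key := fun n => (blockCount_le_blockSum_sqFiber z n).trans
    (blockSum_le_of_letterwise (squareMap z) (f := fun b => (sqFiber b : ℝ)) (g := fun _ => 1)
      (k := bernoulliWeight q) (C := (1 - q) ^ (-s⁻¹)) (a := 1 - s⁻¹) (c := s⁻¹) hC.le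
      (sub_nonneg.2 (inv_le_one_of_one_le₀ hs1.le)) (inv_pos.2 hs0).le (by ring)
      (fun _ _ => Nat.cast_nonneg _) (fun _ _ => one_pos) hpos (fun b hb => by
        rw [Real.one_rpow, one_mul]
        rcases squareMap_range hb with rfl | rfl
        · rw [bernoulliWeight_zero, ← Real.rpow_add q1, sqFiber_zero]
          simp
        · rw [bernoulliWeight_one, sqFiber_one, Real.rpow_neg q1.le, ← div_eq_inv_mul,
            ← Real.div_rpow q0.le q1.le, ← Real.rpow_logb (by norm_num : (0 : ℝ) < 2)
              (by norm_num) (div_pos q0 q1), ← hs, ← Real.rpow_mul (by norm_num),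
            mul_inv_cancel₀ hs0.ne']
          norm_num) n)
  simp only [blockSum_one] at key
  have h := topEntropy_le_of_blockCount_le z (squareMap z) (squareMap z)
    (bernoulliWeight_nonneg q0.le h1.le) hpos hC (inv_pos.2 hs0).le key hm
  have hE : Real.logb 2 (blockSum (squareMap z) (bernoulliWeight q) m) / m < 0 :=
    div_neg_of_neg_of_pos (Real.logb_neg (by norm_num) (blockSum_pos _ hpos m) hlt)
      (by exact_mod_cast hm)
  have hE' := mul_neg_of_pos_of_neg (inv_pos.2 hs0) hE
  rw [Real.logb_rpow_eq_mul_logb_of_pos q1] at h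
  have hH := H_eq_mul_add q0 h1
  rw [← hs, hq] at hH
  have : -s⁻¹ * Real.logb 2 (1 - q) = s⁻¹ * topEntropy (squareMap z) + q := by
    field_simp
    linarith
  linarith

theorem add_lt_topEntropy_of_hasMissingWord {z : ℕ+ → SignType}
    (hz : subshift z = squareMap ⁻¹' subshift (squareMap z))
    (hy : HasMissingWord (squareMap z)) {q : ℝ} (q0 : 0 < q) (h1 : q ≤ 1 / 2)
    (hq : H q = topEntropy (squareMap z)) :
    topEntropy (squareMap z) + q < topEntropy z := by
  have q1 : 0 < 1 - q := by linarith
  obtain ⟨m, hm, hlt⟩ := hy.exists_blockSum_lt q0 (by linarith)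
  set s := Real.logb 2 (q / (1 - q)) with hs
  have hs0 : s ≤ 0 := Real.logb_nonpos (by norm_num) (div_pos q0 q1).le
    ((div_le_one q1).2 (by linarith))
  have ht : 0 < 1 - s := by linarith
  have hpos : ∀ b ∈ Set.range (squareMap z), 0 < bernoulliWeight q b := fun b hb =>
    bernoulliWeight_pos q0 (by linarith) (squareMap_range hb)
  have hC : 0 < (1 - q) ^ (-(1 - s)⁻¹) := Real.rpow_pos_of_pos q1 _
  -- The same identity between letter weights, solved for the weight 1; the exponents are
  -- nonnegative because s ≤ 0.
  have key := fun n =>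
    blockSum_le_of_letterwise (squareMap z) (f := fun _ => 1) (g := fun b => (sqFiber b : ℝ))
      (k := bernoulliWeight q) (C := (1 - q) ^ (-(1 - s)⁻¹)) (a := -s * (1 - s)⁻¹)
      (c := (1 - s)⁻¹) hC.le (mul_nonneg (by linarith) (inv_pos.2 ht).le) (inv_pos.2 ht).le
      (by field_simp; ring) (fun _ _ => zero_le_one)
      (fun b hb => by
        rcases squareMap_range hb with rfl | rfl
        · simp [sqFiber_zero]
        · simp [sqFiber_one]) hpos (fun b hb => by
        rcases squareMap_range hb with rfl | rfl
        · rw [bernoulliWeight_zero, sqFiber_zero, Nat.cast_one, Real.one_rpow, one_mul,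
            ← Real.rpow_add q1]
          simp
        · rw [bernoulliWeight_one, sqFiber_one, Real.rpow_neg q1.le, mul_left_comm,
            ← div_eq_inv_mul, ← Real.div_rpow q0.le q1.le,
            ← Real.rpow_logb (by norm_num : (0 : ℝ) < 2)
              (by norm_num) (div_pos q0 q1), ← hs, ← Real.rpow_mul (by norm_num), Nat.cast_two,
            ← Real.rpow_add (by norm_num)]
          simp) n
  simp only [blockSum_one, ← blockCount_eq_blockSum_sqFiber hz] at key
  have h := topEntropy_le_of_blockCount_le (squareMap z) z (squareMap z)
    (bernoulliWeight_nonneg q0.le (by linarith)) hpos hC (inv_pos.2 ht).le key hm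
  have hE : Real.logb 2 (blockSum (squareMap z) (bernoulliWeight q) m) / m < 0 :=
    div_neg_of_neg_of_pos (Real.logb_neg (by norm_num) (blockSum_pos _ hpos m) hlt)
      (by exact_mod_cast hm)
  set E := Real.logb 2 (blockSum (squareMap z) (bernoulliWeight q) m) / m
  rw [Real.logb_rpow_eq_mul_logb_of_pos q1] at h
  have hH := H_eq_mul_add q0 (by linarith : q < 1)
  rw [← hs, hq] at hH
  have h2 := mul_le_mul_of_nonneg_left h ht.le
  have h3 : (1 - s) * (-(1 - s)⁻¹ * Real.logb 2 (1 - q) + -s * (1 - s)⁻¹ * topEntropy z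
      + (1 - s)⁻¹ * E) = -Real.logb 2 (1 - q) - s * topEntropy z + E := by
    field_simp
    ring
  rw [h3] at h2
  -- What remains is -s(h + q - h_top(z)) ≤ E < 0. No division by -s, which vanishes at q = 1/2.
  by_contra hcon
  nlinarith [mul_nonneg (neg_nonneg.2 hs0) (sub_nonneg.2 (not_lt.1 hcon))]

/-- Covers h = 0, where q = 1 makes the Bernoulli weight degenerate: fibres over letters have size
at most 2. -/
theorem topEntropy_le_add_one (z : ℕ+ → SignType) :
    topEntropy z ≤ topEntropy (squareMap z) + 1 := by
  have key := fun n => (blockCount_le_blockSum_sqFiber z n).trans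
    (blockSum_le_of_letterwise (squareMap z) (f := fun b => (sqFiber b : ℝ)) (g := fun _ => 1)
      (k := fun _ => 1) (C := 2) (a := 1) (c := 0) (by norm_num) zero_le_one le_rfl (by norm_num)
      (fun _ _ => Nat.cast_nonneg _) (fun _ _ => one_pos) (fun _ _ => one_pos) (fun b hb => by
        rcases squareMap_range hb with rfl | rfl
        · simp [sqFiber_zero]
        · simp [sqFiber_one]) n)
  simp only [blockSum_one] at key
  have h := topEntropy_le_of_blockCount_le z (squareMap z) (squareMap z) (w := fun _ => 1)
    (a := 1) (c := 0) (fun _ => zero_le_one) (fun _ _ => one_pos) two_pos le_rfl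
    (fun n => by simpa [blockSum_one] using key n) one_pos
  rw [Real.logb_self_eq_one (by norm_num)] at h
  linarith

/-! ### The inverse branches of H and bounds on f₁, f₂ -/

theorem H₁inv_mem {x : ℝ} (hx : x ∈ Set.Icc (0 : ℝ) 1) :
    H₁inv x ∈ Set.Icc (0 : ℝ) (1 / 2) ∧ H (H₁inv x) = x :=
  ⟨Function.invFunOn_mem (bijOn_H₁.surjOn hx), Function.invFunOn_eq (bijOn_H₁.surjOn hx)⟩

theorem H₂inv_mem {x : ℝ} (hx : x ∈ Set.Icc (0 : ℝ) 1) :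
    H₂inv x ∈ Set.Icc (1 / 2 : ℝ) 1 ∧ H (H₂inv x) = x :=
  ⟨Function.invFunOn_mem (bijOn_H₂.surjOn hx), Function.invFunOn_eq (bijOn_H₂.surjOn hx)⟩

theorem H_zero : H 0 = 0 := by simp [H_eq]

theorem H_one : H 1 = 0 := by simp [H_eq]

theorem H₁inv_zero : H₁inv 0 = 0 := by
  have h := H₁inv_mem (x := 0) (by norm_num)
  exact bijOn_H₁.injOn h.1 (by norm_num) (h.2.trans H_zero.symm)

theorem H₂inv_zero : H₂inv 0 = 1 := by
  have h := H₂inv_mem (x := 0) (by norm_num)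
  exact bijOn_H₂.injOn h.1 (by norm_num) (h.2.trans H_one.symm)

theorem H_strictAntiOn : StrictAntiOn H (Set.Icc (1 / 2) 1) := by
  intro x hx y hy hxy
  rw [H_eq, H_eq]
  refine div_lt_div_of_pos_right (Real.binEntropy_strictAntiOn ?_ ?_ hxy)
    (Real.log_pos (by norm_num)) <;> simpa using (by assumption : _ ∈ Set.Icc (1 / 2 : ℝ) 1)

theorem two_thirds_lt_H₂inv {x : ℝ} (hx : x ∈ Set.Icc (0 : ℝ) 1) (h : x < H (2 / 3)) :
    2 / 3 < H₂inv x := by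
  have hq := H₂inv_mem hx
  rw [← hq.2] at h
  exact (H_strictAntiOn.lt_iff_gt hq.1 (by norm_num)).1 h

theorem H_le_one {x : ℝ} (hx : x ∈ Set.Icc (1 / 2 : ℝ) 1) : H x ≤ 1 := (bijOn_H₂.mapsTo hx).2

theorem H₂inv_lt_one {x : ℝ} (hx : x ∈ Set.Ioc (0 : ℝ) 1) : H₂inv x < 1 := by
  have hq := H₂inv_mem ⟨hx.1.le, hx.2⟩
  refine hq.1.2.lt_of_ne fun h => hx.1.ne' ?_
  rw [← hq.2, h, H_one]

theorem H₁inv_pos {x : ℝ} (hx : x ∈ Set.Ioc (0 : ℝ) 1) : 0 < H₁inv x := by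
  have hq := H₁inv_mem ⟨hx.1.le, hx.2⟩
  refine hq.1.1.lt_of_ne fun h => hx.1.ne' ?_
  rw [← hq.2, ← h, H_zero]

/-- Gibbs' inequality for (q, 1-q) against (2/3, 1/3), from log x ≤ x - 1. -/
theorem H_add_le_logb_three {q : ℝ} (h0 : 0 < q) (h1 : q ≤ 1) : H q + q ≤ Real.logb 2 3 := by
  have hl : 0 < Real.log 2 := Real.log_pos (by norm_num)
  rcases h1.eq_or_lt with rfl | h1
  · rw [H_one, zero_add, Real.le_logb_iff_rpow_le (by norm_num) (by norm_num)]
    norm_num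
  have q1 : 0 < 1 - q := by linarith
  have e1 := mul_le_mul_of_nonneg_left
    (Real.log_le_sub_one_of_pos (by positivity : 0 < 2 / (3 * q))) h0.le
  have e2 := mul_le_mul_of_nonneg_left
    (Real.log_le_sub_one_of_pos (by positivity : 0 < 1 / (3 * (1 - q)))) q1.le
  have e3 : q * (2 / (3 * q) - 1) + (1 - q) * (1 / (3 * (1 - q)) - 1) = 0 := by
    field_simp
    ring
  rw [Real.log_div (by norm_num) (by positivity), Real.log_mul (by norm_num) h0.ne'] at e1
  rw [Real.log_div (by norm_num) (by positivity), Real.log_mul (by norm_num) q1.ne',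
    Real.log_one] at e2
  rw [H, Real.logb, Real.logb, Real.logb, le_div_iff₀ hl]
  have : (-q * (Real.log q / Real.log 2) - (1 - q) * (Real.log (1 - q) / Real.log 2) + q)
      * Real.log 2 = -q * Real.log q - (1 - q) * Real.log (1 - q) + q * Real.log 2 := by
    field_simp
  rw [this]
  linarith

theorem f₂_le_logb_three {x : ℝ} (hx : x ∈ Set.Icc (0 : ℝ) 1) : f₂ x ≤ Real.logb 2 3 := by
  unfold f₂
  split_ifs with h
  · have hq := H₂inv_mem hx
    have := H_add_le_logb_three (by linarith [hq.1.1]) hq.1.2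
    rwa [hq.2] at this
  · exact le_rfl

theorem f₁_lt_logb_three {x : ℝ} (hx : x ∈ Set.Icc (0 : ℝ) 1) : f₁ x < Real.logb 2 3 := by
  -- f₁ is at most 1 + 1/2, and 2³ < 3².
  have h : (3 / 2 : ℝ) < Real.logb 2 3 := by
    rw [Real.logb, lt_div_iff₀ (Real.log_pos (by norm_num))]
    have := Real.log_lt_log (by norm_num) (by norm_num : (2 : ℝ) ^ 3 < 3 ^ 2)
    rw [Real.log_pow, Real.log_pow] at this
    push_cast at this
    linarith
  have := (H₁inv_mem hx).1.2
  unfold f₁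
  linarith [hx.2]

/-! ### Conclusion -/

theorem topEntropy_squareMap_mem (z : ℕ+ → SignType) :
    topEntropy (squareMap z) ∈ Set.Icc (0 : ℝ) 1 :=
  ⟨topEntropy_nonneg _, topEntropy_squareMap_le_one z⟩

theorem topEntropy_lt_f₂ {z : ℕ+ → SignType} (h0 : 0 < topEntropy (squareMap z))
    (h : topEntropy (squareMap z) < H (2 / 3)) :
    topEntropy z < f₂ (topEntropy (squareMap z)) := by
  have hmem := topEntropy_squareMap_mem z
  rw [f₂, if_pos h]
  refine topEntropy_lt_add_of_hasMissingWord ?_ (two_thirds_lt_H₂inv hmem h)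
    (H₂inv_lt_one ⟨h0, hmem.2⟩) (H₂inv_mem hmem).2
  -- Without a missing word h ≥ 1, contradicting h < H(2/3) ≤ 1.
  by_contra hy
  have := one_le_topEntropy_of_not_hasMissingWord hy
  have := H_le_one (x := 2 / 3) (by norm_num)
  linarith

theorem topEntropy_le_f₂ (z : ℕ+ → SignType) : topEntropy z ≤ f₂ (topEntropy (squareMap z)) := by
  have hmem := topEntropy_squareMap_mem z
  by_cases h : topEntropy (squareMap z) < H (2 / 3)
  · rcases hmem.1.eq_or_lt with h0 | h0
    · have := topEntropy_le_add_one z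
      rw [← h0] at h this ⊢
      rwa [f₂, if_pos h, H₂inv_zero]
    · exact (topEntropy_lt_f₂ h0 h).le
  · rw [f₂, if_neg h]
    exact topEntropy_le_logb_three z

theorem f₁_lt_topEntropy {z : ℕ+ → SignType}
    (hz : subshift z = squareMap ⁻¹' subshift (squareMap z))
    (h0 : 0 < topEntropy (squareMap z)) : f₁ (topEntropy (squareMap z)) < topEntropy z := by
  have hmem := topEntropy_squareMap_mem z
  by_cases hy : HasMissingWord (squareMap z)
  · have hq := H₁inv_mem hmem
    exact add_lt_topEntropy_of_hasMissingWord hz hy (H₁inv_pos ⟨h0, hmem.2⟩) hq.1.2 hq.2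
  · exact (f₁_lt_logb_three hmem).trans_le (logb_three_le_topEntropy hy hz)

end SymbDyn

theorem mainTheorem12 (z : ℕ+ → SignType) :
    SymbDyn.topEntropy z ≤ SymbDyn.f₂ (SymbDyn.topEntropy (SymbDyn.squareMap z)) ∧
    (SymbDyn.topEntropy z = Real.logb 2 3 →
      SymbDyn.topEntropy z = SymbDyn.f₂ (SymbDyn.topEntropy (SymbDyn.squareMap z))) ∧
    (0 < SymbDyn.topEntropy (SymbDyn.squareMap z) →
      (SymbDyn.topEntropy z = SymbDyn.f₂ (SymbDyn.topEntropy (SymbDyn.squareMap z)) ↔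
        SymbDyn.topEntropy z = Real.logb 2 3)) ∧
    (SymbDyn.subshift z =
        SymbDyn.squareMap ⁻¹' SymbDyn.subshift (SymbDyn.squareMap z) →
      SymbDyn.f₁ (SymbDyn.topEntropy (SymbDyn.squareMap z)) ≤ SymbDyn.topEntropy z ∧
      (0 < SymbDyn.topEntropy (SymbDyn.squareMap z) →
        SymbDyn.f₁ (SymbDyn.topEntropy (SymbDyn.squareMap z)) < SymbDyn.topEntropy z)) := by
  have hle := SymbDyn.topEntropy_le_f₂ z
  have hmem := SymbDyn.topEntropy_squareMap_mem z
  have hmax : SymbDyn.topEntropy z = Real.logb 2 3 →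
      SymbDyn.topEntropy z = SymbDyn.f₂ (SymbDyn.topEntropy (SymbDyn.squareMap z)) := fun h =>
    le_antisymm hle ((SymbDyn.f₂_le_logb_three hmem).trans_eq h.symm)
  refine ⟨hle, hmax, fun h0 => ⟨fun heq => ?_, hmax⟩,
    fun hz => ⟨?_, fun h0 => SymbDyn.f₁_lt_topEntropy hz h0⟩⟩
  · by_cases h : SymbDyn.topEntropy (SymbDyn.squareMap z) < SymbDyn.H (2 / 3)
    · exact absurd heq (SymbDyn.topEntropy_lt_f₂ h0 h).ne
    · rwa [SymbDyn.f₂, if_neg h] at heq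
  · rcases hmem.1.eq_or_lt with h0 | h0
    · rw [← h0, SymbDyn.f₁, SymbDyn.H₁inv_zero, add_zero]
      exact SymbDyn.topEntropy_nonneg z
    · exact (SymbDyn.f₁_lt_topEntropy hz h0).le
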